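/- Let $(\Omega,\mu)$ be a measure space, let the scalar field be $\mathbb R$ or $\mathbb C$, and let $X$ be a Banach lattice of measurable functions on $\Omega$: a linear space of measurable functions (modulo equality almost everywhere) with a complete norm $\|\cdot\|_X$ such that $f\in X$ and $|g|\le|f|$ a.e. with $g$ measurable imply $g\in X$ and $\|g\|_X\le\|f\|_X$. Suppose that (a) $X$ has the Fatou property: if $f_n\in X$, $\|f_n\|_X\le 1$ for all $n\in\mathbb N$, and $f_n$ converges almost everywhere to a measurable function $f$, then $f\in X$ and $\|f\|_X\le 1$; (b) $X$ is $q$-concave for some $1<q<\infty$: there is a constant $C$ such that $\left(\sum_{i=1}^n\|f_i\|_X^q\right)^{1/q}\le C\,\left\|\left(\sum_{i=1}^n|f_i|^q\right)^{1/q}\right\|_X$ for all $n$ and all $f_1,\dots,f_n\in X$. Then $X$ has order continuous norm: for every sequence $f_n\in X$ such that $\sup_n|f_n|\in X$ and $f_n\to0$ almost everywhere one has $\|f_n\|_X\to0$. -/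

import Mathlib

open MeasureTheory Filter Topology

/-- A Banach lattice (ideal space) of scalar measurable functions on the measure space `(Ω, μ)`:
a linear space of (classes modulo `μ`-a.e. equality of) measurable functions with a complete norm
such that `f ∈ X` and `|g| ≤ |f|` a.e. imply `g ∈ X` and `‖g‖ ≤ ‖f‖`. -/
structure BanachFunctionLattice (𝕜 : Type*) [RCLike 𝕜] {Ω : Type*} [MeasurableSpace Ω]
    (μ : Measure Ω) where
  /-- the functions that belong to the lattice -/
  carrier : Submodule 𝕜 (Ω →ₘ[μ] 𝕜)
  /-- the norm of the lattice -/
  norm : Seminorm 𝕜 carrier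
  /-- the norm is definite -/
  eq_zero_of_norm_eq_zero : ∀ f : carrier, norm f = 0 → f = 0
  /-- the norm is complete -/
  complete : ∀ u : ℕ → carrier,
    (∀ ε : ℝ, 0 < ε → ∃ N : ℕ, ∀ m ≥ N, ∀ n ≥ N, norm (u m - u n) < ε) →
      ∃ f : carrier, Tendsto (fun n => norm (u n - f)) atTop (𝓝 0)
  /-- the ideal property and the monotonicity of the norm -/
  ideal : ∀ (f : carrier) (g : Ω →ₘ[μ] 𝕜),
    (∀ᵐ ω ∂μ, ‖g ω‖ ≤ ‖(f : Ω →ₘ[μ] 𝕜) ω‖) →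
      ∃ hg : g ∈ carrier, norm ⟨g, hg⟩ ≤ norm f

namespace BanachFunctionLattice

variable {𝕜 : Type*} [RCLike 𝕜] {Ω : Type*} [MeasurableSpace Ω] {μ : Measure Ω}

/-- The Fatou property: the a.e. limit of a sequence in the closed unit ball of `X` belongs to `X`
and to its closed unit ball. -/
def HasFatouProperty (X : BanachFunctionLattice 𝕜 μ) : Prop :=
  ∀ (f : ℕ → X.carrier) (g : Ω →ₘ[μ] 𝕜),
    (∀ n, X.norm (f n) ≤ 1) →
    (∀ᵐ ω ∂μ, Tendsto (fun n => (f n : Ω →ₘ[μ] 𝕜) ω) atTop (𝓝 (g ω))) →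
      ∃ hg : g ∈ X.carrier, X.norm ⟨g, hg⟩ ≤ 1

/-- `q`-concavity: for some constant `C` and all finite families `f₁, …, fₙ` in `X`,
`(∑ ‖fᵢ‖^q)^(1/q) ≤ C ‖(∑ |fᵢ|^q)^(1/q)‖`. The function `F = (∑ |fᵢ|^q)^(1/q)` always lies in `X`,
since it is dominated by `∑ |fᵢ|` (for `q ≥ 1`). -/
def IsQConcave (X : BanachFunctionLattice 𝕜 μ) (q : ℝ) : Prop :=
  ∃ C : ℝ, ∀ (n : ℕ) (f : Fin n → X.carrier) (F : X.carrier),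
    (∀ᵐ ω ∂μ, (F : Ω →ₘ[μ] 𝕜) ω =
      (((∑ i, ‖(f i : Ω →ₘ[μ] 𝕜) ω‖ ^ q) ^ (1 / q) : ℝ) : 𝕜)) →
      (∑ i, X.norm (f i) ^ q) ^ (1 / q) ≤ C * X.norm F

/-- Order continuity of the norm: if `fₙ ∈ X`, `F = supₙ |fₙ|` (finite a.e.) belongs to `X` and
`fₙ → 0` a.e., then `‖fₙ‖ → 0`. -/
def HasOrderContinuousNorm (X : BanachFunctionLattice 𝕜 μ) : Prop :=
  ∀ (f : ℕ → X.carrier) (F : X.carrier),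
    (∀ᵐ ω ∂μ, BddAbove (Set.range fun n => ‖(f n : Ω →ₘ[μ] 𝕜) ω‖) ∧
      (F : Ω →ₘ[μ] 𝕜) ω = ((⨆ n, ‖(f n : Ω →ₘ[μ] 𝕜) ω‖ : ℝ) : 𝕜)) →
    (∀ᵐ ω ∂μ, Tendsto (fun n => (f n : Ω →ₘ[μ] 𝕜) ω) atTop (𝓝 0)) →
      Tendsto (fun n => X.norm (f n)) atTop (𝓝 0)

end BanachFunctionLattice

/-! Replace `|fₙ|` by the tail suprema `gₙ`, which decrease to `0` a.e. below `F`. If `‖fₙ‖` does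
not tend to `0`, then `‖gₙ‖ ≥ ε` for all `n`. Since `gₙ - gₘ → gₙ` a.e. as `m → ∞`, the Fatou
property (`HasFatouProperty.norm_le`) gives `m ≥ n` with `‖gₙ - gₘ‖ > ε / 2`; iterating yields a
subsequence whose consecutive differences all exceed `ε / 2` in norm. These differences are
nonnegative with partial sums below `g₀`, so `q`-concavity forbids this
(`IsQConcave.exists_norm_sub_succ_lt`). -/

/-- Superadditivity of `x ↦ x ^ q` on finite sums of nonnegative reals, for `1 ≤ q`. -/
theorem Real.sum_rpow_le_rpow_sum {ι : Type*} (s : Finset ι) (a : ι → ℝ) (ha : ∀ i, 0 ≤ a i)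
    {q : ℝ} (hq : 1 ≤ q) : ∑ i ∈ s, a i ^ q ≤ (∑ i ∈ s, a i) ^ q := by
  classical
  induction s using Finset.induction_on with
  | empty => simp [Real.zero_rpow (by linarith : q ≠ 0)]
  | insert i s hi ih =>
    rw [Finset.sum_insert hi, Finset.sum_insert hi]
    have h := NNReal.add_rpow_le_rpow_add ⟨a i, ha i⟩
      ⟨∑ j ∈ s, a j, Finset.sum_nonneg fun j _ => ha j⟩ hq
    have h' : a i ^ q + (∑ j ∈ s, a j) ^ q ≤ (a i + ∑ j ∈ s, a j) ^ q := by exact_mod_cast h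
    linarith

/-- The tail suprema of a sequence of nonnegative reals that tends to `0` tend to `0`. -/
theorem tendsto_iSup_add_of_tendsto_zero {a : ℕ → ℝ} (h0 : ∀ n, 0 ≤ a n)
    (ha : Tendsto a atTop (𝓝 0)) : Tendsto (fun n => ⨆ k, a (n + k)) atTop (𝓝 0) := by
  rw [Metric.tendsto_atTop] at ha ⊢
  intro ε hε
  obtain ⟨N, hN⟩ := ha (ε / 2) (by positivity)
  refine ⟨N, fun n hn => ?_⟩
  have hle : (⨆ k, a (n + k)) ≤ ε / 2 := ciSup_le fun k => by
    have := hN (n + k) (by omega)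
    rw [Real.dist_0_eq_abs] at this
    exact ((le_abs_self _).trans_lt this).le
  rw [Real.dist_0_eq_abs, abs_of_nonneg (Real.iSup_nonneg fun k => h0 _)]
  linarith

namespace BanachFunctionLattice

variable {𝕜 : Type*} [RCLike 𝕜] {Ω : Type*} [MeasurableSpace Ω] {μ : Measure Ω}

/-- A measurable real function dominated by an element of the lattice belongs to the lattice. -/
theorem exists_coe_ae_eq_of_abs_le (X : BanachFunctionLattice 𝕜 μ) (F : X.carrier) {u : Ω → ℝ}
    (hu : Measurable u) (hle : ∀ᵐ ω ∂μ, |u ω| ≤ ‖(F : Ω →ₘ[μ] 𝕜) ω‖) :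
    ∃ g : X.carrier, ∀ᵐ ω ∂μ, (g : Ω →ₘ[μ] 𝕜) ω = (u ω : 𝕜) := by
  have hm : AEStronglyMeasurable (fun ω => (u ω : 𝕜)) μ :=
    RCLike.continuous_ofReal.comp_aestronglyMeasurable hu.aestronglyMeasurable
  have hcoe := AEEqFun.coeFn_mk _ hm
  obtain ⟨hg, -⟩ := X.ideal F (AEEqFun.mk _ hm) (by
    filter_upwards [hcoe, hle] with ω h1 h2
    rwa [h1, RCLike.norm_ofReal])
  exact ⟨⟨_, hg⟩, hcoe⟩

theorem norm_le_norm_of_ae_le (X : BanachFunctionLattice 𝕜 μ) {f g : X.carrier}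
    (h : ∀ᵐ ω ∂μ, ‖(g : Ω →ₘ[μ] 𝕜) ω‖ ≤ ‖(f : Ω →ₘ[μ] 𝕜) ω‖) : X.norm g ≤ X.norm f :=
  (X.ideal f g h).2

theorem coeFn_sub_ae (X : BanachFunctionLattice 𝕜 μ) (f g : X.carrier) :
    ∀ᵐ ω ∂μ, ((f - g : X.carrier) : Ω →ₘ[μ] 𝕜) ω =
      (f : Ω →ₘ[μ] 𝕜) ω - (g : Ω →ₘ[μ] 𝕜) ω := by
  filter_upwards [AEEqFun.coeFn_sub (f : Ω →ₘ[μ] 𝕜) g] with ω h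
  simpa using h

/-- The Fatou property for balls of arbitrary positive radius. -/
theorem HasFatouProperty.norm_le {X : BanachFunctionLattice 𝕜 μ} (hX : X.HasFatouProperty)
    {f : ℕ → X.carrier} {g : X.carrier} {c : ℝ} (hc : 0 < c) (hf : ∀ n, X.norm (f n) ≤ c)
    (hlim : ∀ᵐ ω ∂μ, Tendsto (fun n => (f n : Ω →ₘ[μ] 𝕜) ω) atTop
      (𝓝 ((g : Ω →ₘ[μ] 𝕜) ω))) : X.norm g ≤ c := by
  have hsmul (v : X.carrier) : X.norm (((c⁻¹ : ℝ) : 𝕜) • v) = c⁻¹ * X.norm v := by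
    rw [map_smul_eq_mul, RCLike.norm_ofReal, abs_of_pos (inv_pos.2 hc)]
  have hcoe (v : X.carrier) : ∀ᵐ ω ∂μ, (((((c⁻¹ : ℝ) : 𝕜) • v : X.carrier)) : Ω →ₘ[μ] 𝕜) ω =
      ((c⁻¹ : ℝ) : 𝕜) * (v : Ω →ₘ[μ] 𝕜) ω := by
    filter_upwards [AEEqFun.coeFn_smul ((c⁻¹ : ℝ) : 𝕜) (v : Ω →ₘ[μ] 𝕜)] with ω h
    simpa using h
  obtain ⟨_, h⟩ := hX (fun n => ((c⁻¹ : ℝ) : 𝕜) • f n)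
    (((((c⁻¹ : ℝ) : 𝕜) • g : X.carrier)) : Ω →ₘ[μ] 𝕜)
    (fun n => by
      rw [hsmul, inv_mul_le_iff₀ hc, mul_one]
      exact hf n)
    (by
      filter_upwards [hlim, hcoe g, ae_all_iff.2 fun n => hcoe (f n)] with ω h1 h2 h3
      simp only [h2, h3]
      exact h1.const_mul _)
  change X.norm (((c⁻¹ : ℝ) : 𝕜) • g) ≤ 1 at h
  rwa [hsmul, inv_mul_le_iff₀ hc, mul_one] at h

/-- In a `q`-concave lattice the differences of consecutive terms of an antitone sequence of
nonnegative functions cannot be bounded away from `0` in norm. -/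
theorem IsQConcave.exists_norm_sub_succ_lt {X : BanachFunctionLattice 𝕜 μ} {q : ℝ} (hq : 1 ≤ q)
    (hX : X.IsQConcave q) {g : ℕ → X.carrier} {u : ℕ → Ω → ℝ}
    (hgu : ∀ n, ∀ᵐ ω ∂μ, (g n : Ω →ₘ[μ] 𝕜) ω = (u n ω : 𝕜))
    (hu : ∀ n, Measurable (u n)) (hu0 : ∀ n ω, 0 ≤ u n ω)
    (hanti : ∀ᵐ ω ∂μ, Antitone fun n => u n ω) {δ : ℝ} (hδ : 0 < δ) :
    ∃ n, X.norm (g n - g (n + 1)) < δ := by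
  have hq0 : 0 < q := by linarith
  obtain ⟨C, hC⟩ := hX
  by_contra! hcon
  -- The right side is independent of `K`, while the left side is `K ^ (1 / q) * δ`.
  have key (K : ℕ) : (K * δ ^ q) ^ (1 / q) ≤ |C| * X.norm (g 0) := by
    -- The `ℓ^q` sum is at most the `ℓ^1` sum, which telescopes to `u 0 - u K ≤ u 0`.
    have hbound : ∀ᵐ ω ∂μ, |(∑ i : Fin K, |u i ω - u (i + 1) ω| ^ q) ^ (1 / q)| ≤
        ‖(g 0 : Ω →ₘ[μ] 𝕜) ω‖ := by
      filter_upwards [hgu 0, hanti] with ω h0 ha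
      rw [h0, RCLike.norm_ofReal, abs_of_nonneg (hu0 0 ω), abs_of_nonneg (by positivity)]
      have htel : ∑ i : Fin K, |u i ω - u (i + 1) ω| = u 0 ω - u K ω := by
        rw [Fin.sum_univ_eq_sum_range (fun i => |u i ω - u (i + 1) ω|) K,
          ← Finset.sum_range_sub' (fun i => u i ω)]
        exact Finset.sum_congr rfl fun i _ => abs_of_nonneg (sub_nonneg.2 (ha i.le_succ))
      have hle := Real.sum_rpow_le_rpow_sum Finset.univ
        (fun i : Fin K => |u i ω - u (i + 1) ω|) (fun i => abs_nonneg _) hq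
      rw [one_div]
      refine (Real.rpow_le_rpow (by positivity) hle (by positivity)).trans ?_
      rw [Real.rpow_rpow_inv (by positivity) hq0.ne', htel]
      linarith [hu0 K ω]
    obtain ⟨F, hF⟩ := X.exists_coe_ae_eq_of_abs_le (g 0) (by fun_prop) hbound
    have hFle : X.norm F ≤ X.norm (g 0) := X.norm_le_norm_of_ae_le (by
      filter_upwards [hF, hbound] with ω h1 h2
      rwa [h1, RCLike.norm_ofReal])
    have hconc := hC K (fun i => g i - g (i + 1)) F (by
      filter_upwards [hF, ae_all_iff.2 hgu, ae_all_iff.2 fun n => X.coeFn_sub_ae (g n) (g (n + 1))]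
        with ω h1 h2 h3
      simp only [h1, h2, h3, ← RCLike.ofReal_sub, RCLike.norm_ofReal])
    calc (K * δ ^ q) ^ (1 / q)
        ≤ (∑ i : Fin K, X.norm (g i - g (i + 1)) ^ q) ^ (1 / q) := by
          refine Real.rpow_le_rpow (by positivity) ?_ (by positivity)
          calc K * δ ^ q = ∑ _i : Fin K, δ ^ q := by simp
            _ ≤ _ := Finset.sum_le_sum fun i _ => Real.rpow_le_rpow hδ.le (hcon i) hq0.le
      -- The sign of `C` is unknown, hence `|C|`.
      _ ≤ C * X.norm F := hconc
      _ ≤ |C| * X.norm (g 0) :=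
          mul_le_mul (le_abs_self C) hFle (apply_nonneg _ _) (abs_nonneg C)
  obtain ⟨K, hK⟩ := exists_nat_gt ((|C| * X.norm (g 0)) ^ q / δ ^ q)
  rw [div_lt_iff₀ (by positivity)] at hK
  have h0 : 0 ≤ |C| * X.norm (g 0) := mul_nonneg (abs_nonneg C) (apply_nonneg _ _)
  have h := key K
  rw [one_div, Real.rpow_inv_le_iff_of_pos (by positivity) h0 hq0] at h
  linarith

end BanachFunctionLattice

theorem proposition6 {𝕜 : Type*} [RCLike 𝕜] {Ω : Type*} [MeasurableSpace Ω] {μ : Measure Ω}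
    (X : BanachFunctionLattice 𝕜 μ) (hFatou : X.HasFatouProperty)
    (hconcave : ∃ q : ℝ, 1 < q ∧ X.IsQConcave q) :
    X.HasOrderContinuousNorm := by
  obtain ⟨q, hq, hX⟩ := hconcave
  intro f F hF hf
  -- Where the tail is unbounded the real supremum is `0`, so `u` is nonnegative everywhere but
  -- known to be antitone only a.e.
  let u : ℕ → Ω → ℝ := fun n ω => ⨆ k, ‖(f (n + k) : Ω →ₘ[μ] 𝕜) ω‖
  have hu (n : ℕ) : Measurable (u n) :=
    Measurable.iSup fun k => (f (n + k) : Ω →ₘ[μ] 𝕜).measurable.norm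
  have hu0 (n : ℕ) (ω : Ω) : 0 ≤ u n ω := Real.iSup_nonneg fun k => norm_nonneg _
  have hbdd : ∀ᵐ ω ∂μ, ∀ n, BddAbove (Set.range fun k => ‖(f (n + k) : Ω →ₘ[μ] 𝕜) ω‖) := by
    filter_upwards [hF] with ω h n
    refine h.1.mono ?_
    rintro _ ⟨k, rfl⟩
    exact ⟨n + k, rfl⟩
  have hanti : ∀ᵐ ω ∂μ, Antitone fun n => u n ω := by
    filter_upwards [hbdd] with ω h m n hmn
    refine ciSup_le fun k => ?_
    have := le_ciSup (h m) (n - m + k)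
    rwa [show m + (n - m + k) = n + k by omega] at this
  have hle (n : ℕ) : ∀ᵐ ω ∂μ, |u n ω| ≤ ‖(F : Ω →ₘ[μ] 𝕜) ω‖ := by
    filter_upwards [hF, hanti] with ω h1 h2
    have h3 : u n ω ≤ u 0 ω := h2 n.zero_le
    have h4 : (⨆ k, ‖(f k : Ω →ₘ[μ] 𝕜) ω‖) = u 0 ω := by simp [u]
    rwa [h1.2, h4, RCLike.norm_ofReal, abs_of_nonneg (hu0 _ _), abs_of_nonneg (hu0 _ _)]
  choose g hg using fun n => X.exists_coe_ae_eq_of_abs_le F (hu n) (hle n)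
  have hlim : ∀ᵐ ω ∂μ, Tendsto (fun n => u n ω) atTop (𝓝 0) := by
    filter_upwards [hf] with ω h
    exact tendsto_iSup_add_of_tendsto_zero (fun n => norm_nonneg _)
      (tendsto_zero_iff_norm_tendsto_zero.1 h)
  have hfg (n k : ℕ) : X.norm (f (n + k)) ≤ X.norm (g n) := X.norm_le_norm_of_ae_le (by
    filter_upwards [hg n, hbdd] with ω h1 h2
    rw [h1, RCLike.norm_ofReal, abs_of_nonneg (hu0 _ _)]
    exact le_ciSup (h2 n) k)
  rw [Metric.tendsto_atTop]
  by_contra! hcon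
  obtain ⟨ε, hε, hcon⟩ := hcon
  have hgε (n : ℕ) : ε ≤ X.norm (g n) := by
    obtain ⟨m, hm, h⟩ := hcon n
    rw [Real.dist_0_eq_abs, abs_of_nonneg (apply_nonneg _ _)] at h
    obtain ⟨k, rfl⟩ := Nat.exists_eq_add_of_le hm
    exact h.trans (hfg n k)
  -- Otherwise the Fatou property would give `‖gₙ‖ ≤ ε / 2`.
  have hgap (n : ℕ) : ∃ m, n ≤ m ∧ ε / 2 < X.norm (g n - g m) := by
    by_contra! h
    have := hFatou.norm_le (f := fun k => g n - g (k + n)) (g := g n) (half_pos hε)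
      (fun k => h _ (Nat.le_add_left n k)) (by
        filter_upwards [ae_all_iff.2 hg, hlim, ae_all_iff.2 fun k => X.coeFn_sub_ae (g n) (g (k + n))]
          with ω h1 h2 h3
        simp only [h3, h1]
        have h4 : Tendsto (fun k => (u (k + n) ω : 𝕜)) atTop (𝓝 ((0 : ℝ) : 𝕜)) :=
          (RCLike.continuous_ofReal.tendsto 0).comp (h2.comp (tendsto_add_atTop_nat n))
        simpa using h4.const_sub (u n ω : 𝕜))
    linarith [hgε n]
  choose φ hφ hφε using hgap
  -- Each index is followed by its `φ`-partner, so the gap `ε / 2` occurs between consecutive terms.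
  let N : ℕ → ℕ := fun k => φ^[k] 0
  have hN (k : ℕ) : N (k + 1) = φ (N k) := Function.iterate_succ_apply' φ k 0
  have hNmono : Monotone N := monotone_nat_of_le_succ fun k => hN k ▸ hφ (N k)
  obtain ⟨n, hn⟩ := hX.exists_norm_sub_succ_lt hq.le (g := fun k => g (N k))
    (u := fun k => u (N k)) (fun k => hg _) (fun k => hu _) (fun k => hu0 _)
    (by filter_upwards [hanti] with ω h using h.comp_monotone hNmono) (half_pos hε)
  simp only [hN] at hn
  exact lt_asymm hn (hφε (N n))
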